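/- Let $F_n$ be the free group on $x_1,\dots,x_n$, let $\Gamma_n(1)=F_n$, $\Gamma_n(k)=[\Gamma_n(k-1),F_n]$ be its lower central series, and let $N_{n,k}=F_n/\Gamma_n(k+1)$ be the free nilpotent group of class $k$. Let $T_{n,k}$ (the tame automorphism group of $N_{n,k}$) be the image of the natural homomorphism $\rho_k:\mathrm{Aut}\,F_n\to\mathrm{Aut}\,N_{n,k}$. Let $H=F_n^{\mathrm{ab}}$, on which $\mathrm{Aut}\,F_n$ acts naturally; for $k\ge 1$ this action factors through $T_{n,k}$, which acts on $N_{n,k}^{\mathrm{ab}}=H$. Let $\partial/\partial x_j:\mathbb Z[F_n]\to\mathbb Z[F_n]$ be the Fox derivations, i.e. the additive maps with $\partial x_i/\partial x_j=\delta_{ij}$ and $\partial(uv)/\partial x_j=\partial u/\partial x_j+u\,\partial v/\partial x_j$ for $u,v\in F_n$, and let $\mathfrak a:\mathbb Z[F_n]\to\mathbb Z[H]$ be the ring homomorphism induced by abelianization. For $\sigma\in\mathrm{Aut}\,F_n$ put $$r_M(\sigma)=\Bigl(\mathfrak a\bigl(\partial \sigma(x_i)/\partial x_j\bigr)\Bigr)_{i,j},\qquad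 \mathrm{sgn}(\sigma)=\det(\sigma|_H)\in\{\pm1\},\qquad f_M(\sigma)=\mathrm{sgn}(\sigma)\det r_M(\sigma)\in\mathbb Z[H].$$ Let $n\ge 2$ and $k\ge 2$. Then $f_M$ takes values in the multiplicative subgroup $H\subset\mathbb Z[H]$ and, with $H$ written additively, it is a crossed homomorphism $\mathrm{Aut}\,F_n\to H$ (Morita's crossed homomorphism). It descends to $T_{n,k}$: there is a crossed homomorphism $f:T_{n,k}\to H$ with $f\circ\rho_k=f_M$. The twisted cohomology group $H^1(T_{n,k},H)$ is infinite cyclic, and it is generated by the class of $f$. -/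

import Mathlib

noncomputable section

namespace TameAut

/-- The free group `F_n` with fixed basis `x_i = FreeGroup.of i`, `i : Fin n`. -/
abbrev F (n : ℕ) : Type := FreeGroup (Fin n)

/-- The abelianization `H` of `F_n`, written multiplicatively. -/
abbrev HMul (n : ℕ) : Type := Abelianization (F n)

/-- The abelianization `H` of `F_n`, written additively, as a `ℤ`-module. -/
abbrev H (n : ℕ) : Type := Additive (HMul n)

/-- The lower central series `Γ_n(1) = F_n`, `Γ_n(k) = [Γ_n(k-1), F_n]`. Mathlib's series starts
at index `0`, so `Γ_n(k + 1)` is its `k`-th term. -/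
abbrev lcs (n k : ℕ) : Subgroup (F n) := (⊤ : Subgroup (F n)).lowerCentralSeries k

/-- The free nilpotent group `N_{n,k} = F_n / Γ_n(k + 1)` of class `k` and rank `n`. -/
abbrev N (n k : ℕ) : Type := F n ⧸ lcs n k

/-- The natural homomorphism `ρ_k : Aut F_n → Aut N_{n,k}` induced by the projection
`F_n → N_{n,k}`. -/
def rho (n k : ℕ) : MulAut (F n) →* MulAut (N n k) where
  toFun σ := QuotientGroup.congr (lcs n k) (lcs n k) σ
    (Subgroup.characteristic_iff_map_eq.mp inferInstance σ)
  map_one' := by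
    ext x
    induction x using QuotientGroup.induction_on with
    | H x => rfl
  map_mul' σ τ := by
    ext x
    induction x using QuotientGroup.induction_on with
    | H x => rfl

/-- The tame automorphism group `T_{n,k}`: the image of `Aut F_n → Aut N_{n,k}`. -/
abbrev T (n k : ℕ) : Subgroup (MulAut (N n k)) := (rho n k).range

/-- The projection `Aut F_n → T_{n,k}`. -/
def proj (n k : ℕ) : MulAut (F n) →* T n k := (rho n k).rangeRestrict

/-- For a group `G`, the natural action of `Aut G` on the abelianization of `G`. -/
def abRep (G : Type) [Group G] : Representation ℤ (MulAut G) (Additive (Abelianization G)) where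
  toFun σ := (MonoidHom.toAdditive (Abelianization.map (σ : G →* G))).toIntLinearMap
  map_one' := by
    ext x
    induction x using Additive.rec with
    | ofMul x =>
      induction x using QuotientGroup.induction_on with
      | H x => rfl
  map_mul' σ τ := by
    ext x
    induction x using Additive.rec with
    | ofMul x =>
      induction x using QuotientGroup.induction_on with
      | H x => rfl

/-- For `k ≥ 1`, `Γ_n(k + 1) ⊆ [F_n, F_n]` lies in the kernel of `F_n → H`. -/
theorem lcs_le_ker (n k : ℕ) (hk : 1 ≤ k) :
    lcs n k ≤ (Abelianization.of : F n →* HMul n).ker := by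
  rw [Abelianization.ker_of]
  refine (Subgroup.lowerCentralSeries_antitone _ hk).trans ?_
  rw [Subgroup.top_lowerCentralSeries_one]

/-- For `k ≥ 1`, the projection `F_n → N_{n,k}` induces an isomorphism of abelianizations. -/
def abEquiv (n k : ℕ) (hk : 1 ≤ k) : HMul n ≃* Abelianization (N n k) :=
  MonoidHom.toMulEquiv
    (Abelianization.map (QuotientGroup.mk' (lcs n k)))
    (Abelianization.lift (QuotientGroup.lift (lcs n k) Abelianization.of (lcs_le_ker n k hk)))
    (by
      ext x
      rfl)
    (by
      ext x
      rfl)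

/-- `abEquiv` as an isomorphism of `ℤ`-modules. -/
def abLinearEquiv (n k : ℕ) (hk : 1 ≤ k) : H n ≃ₗ[ℤ] Additive (Abelianization (N n k)) :=
  (MulEquiv.toAdditive (abEquiv n k hk)).toIntLinearEquiv

/-- The action of `T_{n,k} ⊆ Aut N_{n,k}` on `H`, for `k ≥ 1`: the natural action on the
abelianization of `N_{n,k}`, which is identified with `H` by `abLinearEquiv`. -/
def tameRep (n k : ℕ) (hk : 1 ≤ k) : Representation ℤ (T n k) (H n) where
  toFun g := (abLinearEquiv n k hk).symm.conj (abRep (N n k) (g : MulAut (N n k)))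
  map_one' := by
    ext x
    simp [LinearEquiv.conj_apply]
  map_mul' g h := by
    ext x
    simp [LinearEquiv.conj_apply]

/-- `H` as a `T_{n,k}`-module. -/
abbrev tameH (n k : ℕ) (hk : 1 ≤ k) : Rep ℤ (T n k) := Rep.of (tameRep n k hk)

/-- `H` as an `Aut F_n`-module. -/
abbrev autH (n : ℕ) : Rep ℤ (MulAut (F n)) := Rep.of (abRep (F n))

/-- The action of `T_{n,k}` on `H` is the one induced by the action of `Aut F_n`. -/
theorem tameRep_proj (n k : ℕ) (hk : 1 ≤ k) (σ : MulAut (F n)) :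
    tameRep n k hk (proj n k σ) = abRep (F n) σ := by
  ext x
  induction x using Additive.rec with
  | ofMul x =>
    induction x using QuotientGroup.induction_on with
    | H x => rfl

/-- The affine bijection `y ↦ x_i y + δ_{ij}` of `ℤ[F_n]`. -/
def foxAffine (n : ℕ) (j i : Fin n) : Equiv.Perm (MonoidAlgebra ℤ (F n)) where
  toFun y := MonoidAlgebra.of ℤ (F n) (FreeGroup.of i) * y + if i = j then 1 else 0
  invFun y := MonoidAlgebra.of ℤ (F n) (FreeGroup.of i)⁻¹ * (y - if i = j then 1 else 0)
  left_inv y := by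
    dsimp only
    rw [add_sub_cancel_right, ← mul_assoc, ← map_mul, inv_mul_cancel, map_one, one_mul]
  right_inv y := by
    dsimp only
    rw [← mul_assoc, ← map_mul, mul_inv_cancel, map_one, one_mul, sub_add_cancel]

/-- The Fox free derivative `∂w/∂x_j ∈ ℤ[F_n]` of a word `w ∈ F_n`. Letting `x_i` act on `ℤ[F_n]`
by `y ↦ x_i y + δ_{ij}`, a word `w` acts by `y ↦ w y + ∂w/∂x_j`; it is characterised by
`foxWord_of` and `foxWord_mul` below. -/
def foxWord (n : ℕ) (j : Fin n) (w : F n) : MonoidAlgebra ℤ (F n) :=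
  FreeGroup.lift (foxAffine n j) w 0

theorem foxWord_of (n : ℕ) (i j : Fin n) :
    foxWord n j (FreeGroup.of i) = if i = j then 1 else 0 := by
  simp [foxWord, foxAffine]

theorem foxWord_action (n : ℕ) (j : Fin n) (w : F n) (y : MonoidAlgebra ℤ (F n)) :
    FreeGroup.lift (foxAffine n j) w y = MonoidAlgebra.of ℤ (F n) w * y + foxWord n j w := by
  induction w using FreeGroup.induction_on generalizing y with
  | C1 => simp [foxWord, ← MonoidAlgebra.one_def]
  | of i => simp [foxWord, foxAffine]
  | inv_of i _ =>
    simp only [foxWord, map_inv, FreeGroup.lift_apply_of]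
    simp only [foxAffine, Equiv.Perm.inv_def, Equiv.coe_fn_symm_mk]
    rw [← mul_add, zero_sub, sub_eq_add_neg]
  | mul u v hu hv =>
    rw [foxWord, map_mul, Equiv.Perm.mul_apply, Equiv.Perm.mul_apply, hu, hv, hu, hv, map_mul]
    rw [mul_zero, zero_add, mul_add, mul_assoc, add_assoc]

theorem foxWord_mul (n : ℕ) (j : Fin n) (u v : F n) :
    foxWord n j (u * v) = foxWord n j u + MonoidAlgebra.of ℤ (F n) u * foxWord n j v := by
  rw [foxWord, map_mul, Equiv.Perm.mul_apply, foxWord_action, add_comm]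
  rfl

/-- The Fox derivation `∂/∂x_j : ℤ[F_n] → ℤ[F_n]`, the additive extension of `foxWord`. -/
def foxDeriv (n : ℕ) (j : Fin n) : MonoidAlgebra ℤ (F n) →ₗ[ℤ] MonoidAlgebra ℤ (F n) :=
  (Finsupp.linearCombination ℤ (foxWord n j)).comp
    (MonoidAlgebra.coeffLinearEquiv ℤ).toLinearMap

/-- The ring homomorphism `𝔞 : ℤ[F_n] → ℤ[H]` induced by the abelianization `F_n → H`. -/
def abRing (n : ℕ) : MonoidAlgebra ℤ (F n) →+* MonoidAlgebra ℤ (HMul n) :=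
  MonoidAlgebra.mapDomainRingHom ℤ (Abelianization.of : F n →* HMul n)

/-- The Magnus representation `r_M(σ) = ((∂ σ(x_i) / ∂x_j)^𝔞)_{ij}`. -/
def magnus (n : ℕ) (σ : MulAut (F n)) : Matrix (Fin n) (Fin n) (MonoidAlgebra ℤ (HMul n)) :=
  Matrix.of fun i j =>
    abRing n (foxDeriv n j (MonoidAlgebra.of ℤ (F n) (σ (FreeGroup.of i))))

/-- The signature `sgn(σ)`: the determinant of the action of `σ` on `H`. -/
def sgn (n : ℕ) (σ : MulAut (F n)) : ℤ := LinearMap.det (abRep (F n) σ)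

/-- `f_M(σ) = sgn(σ) det(r_M(σ)) ∈ ℤ[H]`. -/
def moritaElt (n : ℕ) (σ : MulAut (F n)) : MonoidAlgebra ℤ (HMul n) :=
  sgn n σ • (magnus n σ).det

end TameAut

end

/-! The proof tests crossed homomorphisms on the partial conjugations K_ij : x_i ↦ x_j⁻¹ x_i x_j.
Each K_ij acts trivially on H, so principal crossed homomorphisms vanish on it. For a crossed
homomorphism φ on Aut F_n, commutation of K_ij with the inversions of x_l, l ≠ j, forces φ(K_ij) to
be a multiple of the class of x_j, and conjugation by permutations of the generators makes the
multiple independent of (i, j). This single integer is -1 for Morita's crossed homomorphism. If it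
is 0, relations among inversions and transvections show that φ agrees on these generators with a
principal crossed homomorphism (`IsCrossed.exists_principal`). Hence every φ is a multiple of
Morita's up to a principal one, and no nonzero multiple of Morita's is principal.

The same holds on T_{n,k}, a quotient of Aut F_n acting compatibly on H, as soon as f_M descends,
that is, vanishes on the kernel of ρ_k (`moritaFun_eq_zero`). Modulo the square of the augmentation
ideal of ℤ[H], Fox derivatives of elements of Γ_n(3) vanish, so the Magnus matrix of such a σ
becomes the identity; an element h of H is still visible there through its coordinates, by h ↦ 1 +
h_i ε.

That f_M takes values in H, and that a crossed homomorphism is known from inversions and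
transvections, both rest on Nielsen's theorem (`nielsen_eq_top`). It is proved by Nielsen reduction:
lengths of images, refined by a weight that breaks ties, are minimised over a coset of the Nielsen
subgroup. A minimal automorphism shortens no word, so its inverse maps generators to letters. -/

noncomputable section

namespace TameAut

open FreeGroup
open scoped commutatorElement

/-! ### Weights of words, used to break ties in Nielsen reduction -/

section Weight

variable {α : Type*} [Fintype α]

/-- A numerical weight separating words of the same length. -/
def wordWeight (L : List (α × Bool)) : ℕ :=
  Nat.ofDigits (Fintype.card (α × Bool) + 1)
    (L.map fun l => ((Fintype.equivFin (α × Bool) l : Fin _) : ℕ))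

theorem wordWeight_inj {L M : List (α × Bool)} (hl : L.length = M.length)
    (h : wordWeight L = wordWeight M) : L = M := by
  rcases isEmpty_or_nonempty α with hα | hα
  · cases L with
    | nil => simpa using hl.symm
    | cons x _ => exact (IsEmpty.false x.1).elim
  have hcard : 0 < Fintype.card (α × Bool) := Fintype.card_pos
  have := Nat.ofDigits_inj_of_len_eq (b := Fintype.card (α × Bool) + 1) (by omega)
    (by simpa using hl)
    (by
      simp only [List.mem_map]
      rintro _ ⟨x, -, rfl⟩
      exact (Fin.is_lt _).trans (Nat.lt_succ_self _))
    (by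
      simp only [List.mem_map]
      rintro _ ⟨x, -, rfl⟩
      exact (Fin.is_lt _).trans (Nat.lt_succ_self _)) h
  refine List.map_injective_iff.2 ?_ this
  intro a b hab
  exact (Fintype.equivFin (α × Bool)).injective (Fin.ext hab)

/-- The first letter is the least significant digit, so a common suffix adds the same amount to the
weights of two prefixes of equal length. -/
theorem wordWeight_append_lt {p q : List (α × Bool)} (s : List (α × Bool))
    (hl : p.length = q.length) (h : wordWeight p < wordWeight q) :
    wordWeight (p ++ s) < wordWeight (q ++ s) := by
  unfold wordWeight at h ⊢
  rw [List.map_append, List.map_append, Nat.ofDigits_append, Nat.ofDigits_append,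
    List.length_map, List.length_map, hl]
  omega

end Weight

/-! ### Cancellation and word length in free groups -/

section Length

variable {α : Type*} [DecidableEq α]

/-- `P` is the longest common prefix: past it the words begin with different letters, if at all, so
nothing cancels between them. -/
theorem exists_cancellation (A B : List (α × Bool)) (hA : IsReduced A) (hB : IsReduced B) :
    ∃ P a b, A = P ++ a ∧ B = P ++ b ∧ IsReduced (invRev a ++ b) := by
  induction A generalizing B with
  | nil => exact ⟨[], [], B, rfl, rfl, by simpa using hB⟩
  | cons x A ih =>
    cases B with
    | nil =>
      refine ⟨[], x :: A, [], rfl, rfl, ?_⟩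
      rw [List.append_nil, isReduced_iff_reduce_eq, reduce_invRev, hA.reduce_eq]
    | cons y B =>
      by_cases hxy : x = y
      · subst hxy
        obtain ⟨P, a, b, rfl, rfl, h⟩ := ih B (hA.infix ⟨[x], [], by simp⟩)
          (hB.infix ⟨[x], [], by simp⟩)
        exact ⟨x :: P, a, b, rfl, rfl, h⟩
      · refine ⟨[], x :: A, y :: B, rfl, rfl, ?_⟩
        have hA' : IsReduced (invRev (x :: A)) := by
          rw [isReduced_iff_reduce_eq, reduce_invRev, hA.reduce_eq]
        rw [FreeGroup.IsReduced, List.isChain_append]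
        refine ⟨hA', hB, ?_⟩
        intro u hu v hv huv
        simp only [invRev, List.map_cons, List.reverse_cons, List.getLast?_append,
          List.getLast?_singleton, Option.mem_def, Option.some.injEq,
          List.head?_cons, Option.some_or] at hu hv
        subst hu hv
        obtain ⟨x1, x2⟩ := x
        obtain ⟨y1, y2⟩ := y
        simp only at huv ⊢
        subst huv
        cases x2 <;> cases y2 <;> simp_all

theorem toWord_mk_of_norm_eq (L : List (α × Bool)) (h : (mk L).norm = L.length) :
    (mk L).toWord = L := by
  rw [toWord_mk]
  exact (reduce.red (L := L)).sublist.eq_of_length (by rwa [FreeGroup.norm, toWord_mk] at h)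

/-- The Gromov product of `g` and `h` is the length of the longest common prefix of their reduced
words. -/
theorem exists_gromovProduct (g h : FreeGroup α) :
    ∃ k, g.norm + h.norm = (g⁻¹ * h).norm + 2 * k ∧
      ∀ m, m ≤ k ↔ m ≤ g.norm ∧ m ≤ h.norm ∧ g.toWord.take m = h.toWord.take m := by
  obtain ⟨P, a, b, hg, hh, hab⟩ :=
    exists_cancellation g.toWord h.toWord isReduced_toWord isReduced_toWord
  have key : (g⁻¹ * h).norm = a.length + b.length := by
    have : g⁻¹ * h = mk (invRev a ++ b) := by
      rw [← mk_toWord (x := g), ← mk_toWord (x := h), hg, hh, ← mul_mk, ← mul_mk, ← mul_mk,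
        ← inv_mk]
      group
    rw [this, FreeGroup.norm, toWord_mk, hab.reduce_eq, List.length_append, invRev_length]
  have hgn : g.norm = P.length + a.length := by rw [FreeGroup.norm, hg, List.length_append]
  have hhn : h.norm = P.length + b.length := by rw [FreeGroup.norm, hh, List.length_append]
  refine ⟨P.length, by omega, fun m => ⟨fun hm => ⟨by omega, by omega, ?_⟩, ?_⟩⟩
  · rw [hg, hh, List.take_append_of_le_length hm, List.take_append_of_le_length hm]
  · rintro ⟨h1, h2, h3⟩
    -- Agreement of the first `m` letters removes at least `2 * m` letters from the product, which
    -- bounds `m` by the Gromov product.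
    have hle : (g⁻¹ * h).norm ≤ (g.norm - m) + (h.norm - m) := by
      have : g⁻¹ * h = mk (invRev (g.toWord.drop m) ++ h.toWord.drop m) := by
        conv_lhs => rw [← mk_toWord (x := g), ← mk_toWord (x := h),
          ← List.take_append_drop m g.toWord, ← List.take_append_drop m h.toWord, h3]
        rw [← mul_mk, ← mul_mk, ← mul_mk, ← inv_mk]
        group
      rw [this]
      refine norm_mk_le.trans ?_
      rw [List.length_append, invRev_length, List.length_drop, List.length_drop]
      rfl
    omega

theorem norm_mul_parity (g h : FreeGroup α) : ∃ k, g.norm + h.norm = (g * h).norm + 2 * k := by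
  obtain ⟨k, hk, -⟩ := exists_gromovProduct g⁻¹ h
  rw [inv_inv, norm_inv_eq] at hk
  exact ⟨k, hk⟩

/-- If the cancellations in `x * y` and in `y * z` do not exhaust `y`, they do not interact. -/
theorem norm_mul_mul (x y z : FreeGroup α)
    (h : x.norm + z.norm < (x * y).norm + (y * z).norm) :
    (x * y * z).norm + y.norm = (x * y).norm + (y * z).norm := by
  obtain ⟨p, hp, hp'⟩ := exists_gromovProduct x⁻¹ y
  obtain ⟨q, hq, hq'⟩ := exists_gromovProduct y (y * z)
  obtain ⟨r, hr, hr'⟩ := exists_gromovProduct x⁻¹ (y * z)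
  rw [inv_inv] at hp hr
  rw [inv_mul_cancel_left] at hq
  rw [norm_inv_eq] at hp hr
  rw [← mul_assoc] at hr
  -- This is the hypothesis rewritten. Gromov products in a tree are ultrametric, so `p < q` forces
  -- `r = p`, which is the claim.
  have hpq : p < q := by omega
  have h1 := (hp' p).1 le_rfl
  have h2 := (hq' p).1 hpq.le
  have h3 := (hr' p).2 ⟨h1.1, h2.2.1, h1.2.2.trans h2.2.2⟩
  have h4 : r ≤ p := by
    by_contra! hlt
    have h5 := (hr' (p + 1)).1 hlt
    have h6 := (hq' (p + 1)).1 hpq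
    have := (hp' (p + 1)).2 ⟨h5.1, h6.1, h5.2.2.trans h6.2.2.symm⟩
    omega
  omega

/-- Write y = c d c⁻¹ with d cyclically reduced and nonempty; then y² = c d d c⁻¹ is reduced. -/
theorem norm_lt_norm_mul_self {y : FreeGroup α} (hy : y ≠ 1) : y.norm < (y * y).norm := by
  have h := reduceCyclically.reduce_flatten_replicate_succ (isReduced_toWord (x := y)) 1
  have h2 : (y * y).toWord = reduce (List.replicate 2 y.toWord).flatten := by
    rw [← pow_two, toWord_pow]
  have h3 := reduceCyclically.conj_conjugator_reduceCyclically y.toWord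
  have h4 : 0 < (reduceCyclically y.toWord).length := by
    refine List.length_pos_iff.2 fun h0 => hy ?_
    rw [h0, List.append_nil] at h3
    rw [← mk_toWord (x := y), ← h3, ← mul_mk, ← inv_mk, mul_inv_cancel]
  rw [FreeGroup.norm, FreeGroup.norm, h2, h, ← congrArg List.length h3]
  simpa using h4

theorem take_eq_of_norm_mul_eq {x y : FreeGroup α} {m : ℕ} (hy : y.norm = 2 * m)
    (hxy : (x * y).norm = x.norm) : m ≤ x.norm ∧ x⁻¹.toWord.take m = y.toWord.take m := by
  obtain ⟨k, hk, hk'⟩ := exists_gromovProduct x⁻¹ y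
  rw [inv_inv, norm_inv_eq] at hk
  have := (hk' m).1 (by omega)
  rw [norm_inv_eq] at this
  exact ⟨this.1, this.2.2⟩

variable [Fintype α]

/-- The weight of the initial half of the reduced word. -/
def halfWeight (g : FreeGroup α) : ℕ := wordWeight (g.toWord.take ((g.norm + 1) / 2))

/-- Here y = p q⁻¹ and z = q c, so the product is p c: the prefix q is replaced by p. Since y is no
longer than z, this prefix lies in the initial half of z, while the half read from the other end
lies in c and is unchanged. -/
theorem norm_halfWeight_mul_lt {y z : FreeGroup α} {m : ℕ} (hy : y.norm = 2 * m)
    (hyz : (y * z).norm = z.norm) (hle : y.norm ≤ z.norm)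
    (hlt : wordWeight (y.toWord.take m) < wordWeight (y⁻¹.toWord.take m)) :
    halfWeight (y * z) + halfWeight (y * z)⁻¹ < halfWeight z + halfWeight z⁻¹ := by
  obtain ⟨k, hk, hk'⟩ := exists_gromovProduct y⁻¹ z
  rw [inv_inv, norm_inv_eq] at hk
  have hpre := ((hk' m).1 (by omega)).2.2
  set p := y.toWord.take m with hp
  set q := y⁻¹.toWord.take m with hq
  set c := z.toWord.drop m with hc
  have hz : z.toWord = q ++ c := by rw [hpre, hc, List.take_append_drop]
  have hpl : p.length = m := by
    rw [hp, List.length_take, show y.toWord.length = 2 * m from hy]; omega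
  have hql : q.length = m := by
    rw [hq, List.length_take, toWord_inv, invRev_length, show y.toWord.length = 2 * m from hy]
    omega
  have hzl : z.norm = m + c.length := by rw [FreeGroup.norm, hz, List.length_append, hql]
  have hyd : y.toWord = p ++ invRev q := by
    have : y.toWord = invRev (y⁻¹.toWord.drop m) ++ invRev q := by
      rw [← invRev_append, hq, List.take_append_drop, toWord_inv, invRev_invRev]
    have h2 : (invRev (y⁻¹.toWord.drop m)).length = m := by
      rw [invRev_length, List.length_drop, toWord_inv, invRev_length,
        show y.toWord.length = 2 * m from hy]
      omega
    have h3 : p = invRev (y⁻¹.toWord.drop m) := by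
      rw [hp, this, List.take_left' h2]
    rw [h3]; exact this
  have hmul : y * z = mk (p ++ c) := by
    rw [← mk_toWord (x := y), ← mk_toWord (x := z), hyd, hz]
    simp only [← mul_mk, ← inv_mk]
    group
  have hword : (y * z).toWord = p ++ c := by
    rw [hmul]
    apply toWord_mk_of_norm_eq
    rw [← hmul, hyz, hzl, List.length_append, hpl]
  have hcl : (z.norm + 1) / 2 ≤ c.length := by omega
  have hml : m ≤ (z.norm + 1) / 2 := by omega
  have h1 : halfWeight (y * z)⁻¹ = halfWeight z⁻¹ := by
    unfold halfWeight
    rw [norm_inv_eq, norm_inv_eq, hyz, toWord_inv, toWord_inv, hword, hz, invRev_append,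
      invRev_append, List.take_append_of_le_length (by simpa using hcl),
      List.take_append_of_le_length (by simpa using hcl)]
  have h2 : halfWeight (y * z) < halfWeight z := by
    unfold halfWeight
    rw [hyz, hword, hz, List.take_append, List.take_append, hpl, hql,
      List.take_of_length_le (hpl.le.trans hml), List.take_of_length_le (hql.le.trans hml)]
    exact wordWeight_append_lt _ (hpl.trans hql.symm) hlt
  omega

end Length

/-! ### Nielsen automorphisms and signed permutations -/

section Generators

variable {n : ℕ}

/-- The automorphism `x_i ↦ x_i⁻¹` fixing the other generators. -/
def inversion (i : Fin n) : MulAut (F n) :=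
  MonoidHom.toMulEquiv (FreeGroup.lift (Function.update of i (of i)⁻¹))
    (FreeGroup.lift (Function.update of i (of i)⁻¹))
    (by
      ext l
      by_cases h : l = i
      · subst h; simp
      · simp [h])
    (by
      ext l
      by_cases h : l = i
      · subst h; simp
      · simp [h])

/-- The automorphism `x_i ↦ x_i x_j` fixing the other generators. -/
def transvection (i j : Fin n) (hij : i ≠ j) : MulAut (F n) :=
  MonoidHom.toMulEquiv (FreeGroup.lift (Function.update of i (of i * of j)))
    (FreeGroup.lift (Function.update of i (of i * (of j)⁻¹)))
    (by
      ext l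
      by_cases h : l = i
      · subst h; simp [hij.symm]
      · simp [h])
    (by
      ext l
      by_cases h : l = i
      · subst h; simp [hij.symm]
      · simp [h])

@[simp]
theorem inversion_of_self (i : Fin n) : inversion i (of i) = (of i)⁻¹ := by
  change FreeGroup.lift (Function.update of i (of i)⁻¹) (of i) = _
  simp

@[simp]
theorem inversion_of_ne {i l : Fin n} (h : l ≠ i) : inversion i (of l) = of l := by
  change FreeGroup.lift (Function.update of i (of i)⁻¹) (of l) = _
  simp [h]

@[simp]
theorem transvection_of_self {i j : Fin n} (hij : i ≠ j) :
    transvection i j hij (of i) = of i * of j := by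
  change FreeGroup.lift (Function.update of i (of i * of j)) (of i) = _
  simp

@[simp]
theorem transvection_of_ne {i j l : Fin n} (hij : i ≠ j) (h : l ≠ i) :
    transvection i j hij (of l) = of l := by
  change FreeGroup.lift (Function.update of i (of i * of j)) (of l) = _
  simp [h]

@[simp]
theorem transvection_symm_of_self {i j : Fin n} (hij : i ≠ j) :
    (transvection i j hij).symm (of i) = of i * (of j)⁻¹ := by
  change FreeGroup.lift (Function.update of i (of i * (of j)⁻¹)) (of i) = _
  simp

@[simp]
theorem transvection_symm_of_ne {i j l : Fin n} (hij : i ≠ j) (h : l ≠ i) :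
    (transvection i j hij).symm (of l) = of l := by
  change FreeGroup.lift (Function.update of i (of i * (of j)⁻¹)) (of l) = _
  simp [h]

theorem mulAut_ext {σ τ : MulAut (F n)} (h : ∀ l, σ (of l) = τ (of l)) : σ = τ := by
  have : (σ : F n →* F n) = τ := FreeGroup.ext_hom _ _ h
  ext x
  exact DFunLike.congr_fun this x

theorem inversion_mul_self (i : Fin n) : inversion i * inversion i = 1 := by
  apply mulAut_ext
  intro l
  by_cases h : l = i
  · subst h; simp
  · simp [h]

/-- The subgroup of `Aut F_n` generated by the elementary Nielsen automorphisms. -/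
def nielsen (n : ℕ) : Subgroup (MulAut (F n)) :=
  Subgroup.closure (Set.range inversion ∪
    {σ | ∃ (i j : Fin n) (hij : i ≠ j), σ = transvection i j hij})

theorem inversion_mem (i : Fin n) : inversion i ∈ nielsen n :=
  Subgroup.subset_closure (Or.inl ⟨i, rfl⟩)

theorem transvection_mem {i j : Fin n} (hij : i ≠ j) : transvection i j hij ∈ nielsen n :=
  Subgroup.subset_closure (Or.inr ⟨i, j, hij, rfl⟩)

/-- The automorphism `x_i ↦ x_j x_i` fixing the other generators. -/
def leftTransvection (i j : Fin n) (hij : i ≠ j) : MulAut (F n) :=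
  inversion i * (transvection i j hij)⁻¹ * inversion i

theorem leftTransvection_mem {i j : Fin n} (hij : i ≠ j) : leftTransvection i j hij ∈ nielsen n :=
  mul_mem (mul_mem (inversion_mem i) (inv_mem (transvection_mem hij))) (inversion_mem i)

@[simp]
theorem leftTransvection_of_self {i j : Fin n} (hij : i ≠ j) :
    leftTransvection i j hij (of i) = of j * of i := by
  simp [leftTransvection, hij.symm]

@[simp]
theorem leftTransvection_of_ne {i j l : Fin n} (hij : i ≠ j) (h : l ≠ i) :
    leftTransvection i j hij (of l) = of l := by
  simp [leftTransvection, h]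

@[simp]
theorem leftTransvection_symm_of_self {i j : Fin n} (hij : i ≠ j) :
    (leftTransvection i j hij).symm (of i) = (of j)⁻¹ * of i := by
  rw [MulEquiv.symm_apply_eq]
  simp [hij.symm]

@[simp]
theorem leftTransvection_symm_of_ne {i j l : Fin n} (hij : i ≠ j) (h : l ≠ i) :
    (leftTransvection i j hij).symm (of l) = of l := by
  rw [MulEquiv.symm_apply_eq]
  simp [h]

/-- The automorphism of `F_n` permuting the generators. -/
def permAut (e : Equiv.Perm (Fin n)) : MulAut (F n) := FreeGroup.freeGroupCongr e

@[simp]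
theorem permAut_of (e : Equiv.Perm (Fin n)) (l : Fin n) : permAut e (of l) = of (e l) := by
  simp [permAut]

theorem permAut_mul (e f : Equiv.Perm (Fin n)) : permAut (e * f) = permAut e * permAut f := by
  apply mulAut_ext
  simp

/-- As for 2 × 2 matrices, three transvections swap two generators up to a sign, which the inversion
corrects. -/
theorem permAut_swap {i j : Fin n} (hij : i ≠ j) :
    permAut (Equiv.swap i j) = transvection i j hij * (transvection j i hij.symm)⁻¹ *
      leftTransvection i j hij * inversion j := by
  apply mulAut_ext
  intro l
  by_cases hi : l = i
  · subst hi
    simp [hij, hij.symm]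
  by_cases hj : l = j
  · subst hj
    simp [hij.symm]
  · simp [hi, hj, Equiv.swap_apply_of_ne_of_ne]

theorem permAut_mem (e : Equiv.Perm (Fin n)) : permAut e ∈ nielsen n := by
  induction e using Equiv.Perm.swap_induction_on with
  | one =>
    convert one_mem (nielsen n)
    apply mulAut_ext
    simp
  | swap_mul f x y hxy ih =>
    rw [permAut_mul, permAut_swap hxy]
    exact mul_mem (mul_mem (mul_mem (mul_mem (transvection_mem _) (inv_mem (transvection_mem _)))
      (leftTransvection_mem _)) (inversion_mem _)) ih

theorem mem_nielsen_of_signed_perm (e : Equiv.Perm (Fin n)) (s : Finset (Fin n))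
    (τ : MulAut (F n)) (h : ∀ k, τ (of k) = if k ∈ s then (of (e k))⁻¹ else of (e k)) :
    τ ∈ nielsen n := by
  induction s using Finset.induction_on generalizing τ with
  | empty =>
    rw [show τ = permAut e from mulAut_ext (by simpa using h)]
    exact permAut_mem e
  | insert a s ha ih =>
    have := ih (τ * inversion a) (fun k => by
      by_cases hk : k = a
      · subst hk; simp [h, ha]
      · simp [h, hk])
    have h2 := mul_mem this (inversion_mem a)
    rwa [mul_assoc, inversion_mul_self, mul_one] at h2

theorem mem_nielsen_of_letters (τ : MulAut (F n)) (h : ∀ k, ∃ l, τ (of k) = mk [l]) :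
    τ ∈ nielsen n := by
  choose l hl using h
  have hinj : Function.Injective fun k => (l k).1 := by
    intro k k' hkk
    by_contra hne
    have hne' : l k ≠ l k' := fun h => hne (of_injective (τ.injective (by rw [hl, hl, h])))
    have h2 : τ (of k) = τ (of k')⁻¹ := by
      rw [_root_.map_inv, hl, hl, inv_mk]
      simp only [invRev, List.map_cons, List.map_nil, List.reverse_singleton]
      congr 2
      refine Prod.ext hkk ?_
      dsimp only at hkk
      revert hne' hkk
      rcases l k with ⟨a, _ | _⟩ <;> rcases l k' with ⟨b, _ | _⟩ <;> simp
    -- A generator is never the inverse of a generator.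
    have h3 := congrArg toWord (τ.injective h2)
    simp [toWord_inv, invRev] at h3
  refine mem_nielsen_of_signed_perm
    (Equiv.ofBijective _ (Finite.injective_iff_bijective.1 hinj))
    (Finset.univ.filter fun k => (l k).2 = false) τ fun k => ?_
  rw [hl]
  simp only [Finset.mem_filter, Finset.mem_univ, true_and, Equiv.ofBijective_apply]
  rcases l k with ⟨a, _ | _⟩ <;> simp [of, inv_mk, invRev]

end Generators

/-! ### Nielsen reduction and Nielsen's theorem -/

section Minimal

variable {n : ℕ}

/-- The complexity of an element of `F_n`: its length, and in case of ties the weights of the two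
halves of its reduced word. -/
def complexity (g : F n) : ℕ ×ₗ ℕ := toLex (g.norm, halfWeight g + halfWeight g⁻¹)

theorem complexity_inv (g : F n) : complexity g⁻¹ = complexity g := by
  simp [complexity, add_comm]

theorem norm_le_of_not_complexity_lt {g h : F n} (H : ¬ complexity g < complexity h) :
    h.norm ≤ g.norm := by
  by_contra! hlt
  exact H (Prod.Lex.toLex_lt_toLex.2 (Or.inl hlt))

/-- The complexity of an automorphism. -/
def totalComplexity (σ : MulAut (F n)) : ℕ ×ₗ ℕ :=
  toLex (∑ i, (σ (of i)).norm, ∑ i, (halfWeight (σ (of i)) + halfWeight (σ (of i))⁻¹))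

theorem totalComplexity_lt {σ τ : MulAut (F n)} (i : Fin n)
    (h : ∀ l, l ≠ i → σ (of l) = τ (of l)) (hi : complexity (σ (of i)) < complexity (τ (of i))) :
    totalComplexity σ < totalComplexity τ := by
  have key : ∀ φ : F n → ℕ, ∃ c, ∑ l, φ (σ (of l)) = φ (σ (of i)) + c ∧
      ∑ l, φ (τ (of l)) = φ (τ (of i)) + c := fun φ => by
    refine ⟨∑ l ∈ Finset.univ.erase i, φ (σ (of l)), ?_, ?_⟩
    · rw [Finset.add_sum_erase _ (fun l => φ (σ (of l))) (Finset.mem_univ i)]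
    · rw [Finset.sum_congr rfl fun l hl => congrArg φ (h l (Finset.ne_of_mem_erase hl)),
        Finset.add_sum_erase _ (fun l => φ (τ (of l))) (Finset.mem_univ i)]
  obtain ⟨c, hc, hc'⟩ := key FreeGroup.norm
  obtain ⟨d, hd, hd'⟩ := key fun g => halfWeight g + halfWeight g⁻¹
  unfold totalComplexity
  rw [hc, hc', hd, hd']
  rcases Prod.Lex.toLex_lt_toLex.1 hi with h1 | ⟨h1, h2⟩
  · exact Prod.Lex.toLex_lt_toLex.2 (Or.inl (by simpa using h1))
  · exact Prod.Lex.toLex_lt_toLex.2 (Or.inr ⟨by simpa using h1, by simpa using h2⟩)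

/-- An automorphism is minimal if no Nielsen automorphism lowers its complexity. -/
def IsMinimal (σ : MulAut (F n)) : Prop :=
  ∀ κ ∈ nielsen n, ¬ totalComplexity (σ * κ) < totalComplexity σ

theorem exists_isMinimal (σ : MulAut (F n)) : ∃ τ ∈ nielsen n, IsMinimal (σ * τ) := by
  obtain ⟨-, ⟨τ, hτ, rfl⟩, hmin⟩ := (wellFounded_lt (α := ℕ ×ₗ ℕ)).has_min
    ((fun τ => totalComplexity (σ * τ)) '' (nielsen n : Set (MulAut (F n))))
    ⟨_, 1, one_mem _, rfl⟩
  refine ⟨τ, hτ, fun κ hκ => ?_⟩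
  rw [mul_assoc]
  exact hmin _ ⟨τ * κ, mul_mem hτ hκ, rfl⟩

theorem IsMinimal.not_lt {σ : MulAut (F n)} (hσ : IsMinimal σ) {κ : MulAut (F n)}
    (hκ : κ ∈ nielsen n) (i : Fin n) (h : ∀ l, l ≠ i → κ (of l) = of l) :
    ¬ complexity (σ (κ (of i))) < complexity (σ (of i)) := fun H =>
  hσ κ hκ (totalComplexity_lt i (fun l hl => by rw [MulAut.mul_apply, h l hl]) H)

/-- Complexity is invariant under inversion, so all choices of signs and sides reduce to the right
and left transvections and their inverses. -/
theorem IsMinimal.not_mul_letter_lt {σ : MulAut (F n)} (hσ : IsMinimal σ) {l m : Fin n × Bool}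
    (h : l.1 ≠ m.1) :
    ¬ complexity (σ (mk [l]) * σ (mk [m])) < complexity (σ (mk [l])) ∧
      ¬ complexity (σ (mk [m]) * σ (mk [l])) < complexity (σ (mk [l])) := by
  obtain ⟨i, b⟩ := l
  obtain ⟨j, c⟩ := m
  have hij : i ≠ j := h
  have e1 : ∀ i : Fin n, mk [(i, true)] = of i := fun _ => rfl
  have e2 : ∀ i : Fin n, mk [(i, false)] = (of i)⁻¹ := fun _ => rfl
  have r1 := hσ.not_lt (transvection_mem hij) i fun l hl => transvection_of_ne hij hl
  have r2 := hσ.not_lt (inv_mem (transvection_mem hij)) i fun l hl => transvection_symm_of_ne hij hl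
  have r3 := hσ.not_lt (leftTransvection_mem hij) i fun l hl => leftTransvection_of_ne hij hl
  have r4 := hσ.not_lt (inv_mem (leftTransvection_mem hij)) i
    fun l hl => leftTransvection_symm_of_ne hij hl
  rw [transvection_of_self, _root_.map_mul] at r1
  rw [MulAut.inv_apply, transvection_symm_of_self, _root_.map_mul] at r2
  rw [leftTransvection_of_self, _root_.map_mul] at r3
  rw [MulAut.inv_apply, leftTransvection_symm_of_self, _root_.map_mul] at r4
  have r1' := r1
  have r2' := r2
  have r3' := r3
  have r4' := r4
  rw [← complexity_inv, ← complexity_inv (σ (of i)), mul_inv_rev] at r1' r2' r3' r4'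
  cases b <;> cases c <;> simp only [e1, e2, _root_.map_inv, inv_inv] at * <;>
    exact ⟨by assumption, by assumption⟩

/-- Two letters may follow one another in a reduced word. -/
def Composable (l m : Fin n × Bool) : Prop := l.1 = m.1 → l.2 = m.2

theorem Composable.eq_or_ne {l m : Fin n × Bool} (h : Composable l m) : l = m ∨ l.1 ≠ m.1 := by
  by_cases hlm : l.1 = m.1
  · exact Or.inl (Prod.ext hlm (h hlm))
  · exact Or.inr hlm

theorem letter_ne_one (σ : MulAut (F n)) (l : Fin n × Bool) : σ (mk [l]) ≠ 1 := by
  rw [Ne, EmbeddingLike.map_eq_one_iff, ← toWord_eq_nil_iff, toWord_mk]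
  simp

/-- Nielsen's first condition: minimality gives it for distinct generators, growth of squares for
equal letters. -/
theorem IsMinimal.norm_le_norm_mul {σ : MulAut (F n)} (hσ : IsMinimal σ) {l m : Fin n × Bool}
    (h : Composable l m) :
    (σ (mk [l])).norm ≤ (σ (mk [l]) * σ (mk [m])).norm ∧
      (σ (mk [m])).norm ≤ (σ (mk [l]) * σ (mk [m])).norm := by
  rcases h.eq_or_ne with rfl | h
  · have := (norm_lt_norm_mul_self (letter_ne_one σ l)).le
    exact ⟨this, this⟩
  · exact ⟨norm_le_of_not_complexity_lt (hσ.not_mul_letter_lt h).1,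
      norm_le_of_not_complexity_lt (hσ.not_mul_letter_lt h.symm).2⟩

/-- Nielsen's second condition: the neighbours of the middle factor y do not cancel all of it.
Otherwise each cancels exactly half of y; the halves have different weights, and absorbing y into
one neighbour keeps its length but lowers its weight. -/
theorem IsMinimal.norm_add_norm_lt {σ : MulAut (F n)} (hσ : IsMinimal σ)
    {l m r : Fin n × Bool} (hlm : Composable l m) (hmr : Composable m r) :
    (σ (mk [l])).norm + (σ (mk [r])).norm <
      (σ (mk [l]) * σ (mk [m])).norm + (σ (mk [m]) * σ (mk [r])).norm := by
  by_contra! hle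
  have h1 := hσ.norm_le_norm_mul hlm
  have h2 := hσ.norm_le_norm_mul hmr
  have h3 := hσ.not_mul_letter_lt (l := l) (m := m)
  have h4 := hσ.not_mul_letter_lt (l := r) (m := m)
  have hne := letter_ne_one σ m
  set x := σ (mk [l]) with hx
  set y := σ (mk [m]) with hy
  set z := σ (mk [r]) with hz
  obtain ⟨k, hk⟩ := norm_mul_parity x y
  have hxy : (x * y).norm = x.norm := by omega
  have hyz : (y * z).norm = z.norm := by omega
  have hyk : y.norm = 2 * k := by omega
  have hzy : (z⁻¹ * y⁻¹).norm = z⁻¹.norm := by rw [← mul_inv_rev, norm_inv_eq, norm_inv_eq, hyz]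
  have hyx : (y⁻¹ * x⁻¹).norm = x⁻¹.norm := by rw [← mul_inv_rev, norm_inv_eq, norm_inv_eq, hxy]
  have hyk' : y⁻¹.norm = 2 * k := by rw [norm_inv_eq, hyk]
  have tx := take_eq_of_norm_mul_eq hyk hxy
  have tz := take_eq_of_norm_mul_eq hyk' hzy
  rw [inv_inv] at tz
  -- Equal halves would make the square of y⁻¹ no longer than y⁻¹.
  have hpq : y.toWord.take k ≠ y⁻¹.toWord.take k := by
    intro hpq
    obtain ⟨q, hq, hq'⟩ := exists_gromovProduct y y⁻¹
    have := (hq' k).2 ⟨by omega, by omega, hpq⟩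
    have := norm_lt_norm_mul_self (inv_ne_one.2 hne)
    omega
  have hlen : (y.toWord.take k).length = (y⁻¹.toWord.take k).length := by
    rw [List.length_take, List.length_take, toWord_inv, invRev_length]
  rcases lt_trichotomy (wordWeight (y.toWord.take k)) (wordWeight (y⁻¹.toWord.take k)) with
    h | h | h
  · have hlt := norm_halfWeight_mul_lt hyk hyz (by omega) h
    rcases hmr.eq_or_ne with rfl | hne'
    · exact hpq tz.2
    · exact (h4 hne'.symm).2 (Prod.Lex.toLex_lt_toLex.2 (Or.inr ⟨hyz, hlt⟩))
  · exact hpq (wordWeight_inj hlen h)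
  · have hlt := norm_halfWeight_mul_lt hyk' hyx (by rw [norm_inv_eq, norm_inv_eq]; omega)
      (by rwa [inv_inv])
    rcases hlm.eq_or_ne with rfl | hne'
    · exact hpq tx.2.symm
    · refine (h3 hne').1 ?_
      rw [← complexity_inv, ← complexity_inv x, mul_inv_rev]
      exact Prod.Lex.toLex_lt_toLex.2 (Or.inr ⟨hyx, hlt⟩)

theorem isReduced_cons_cons {l m : Fin n × Bool} {w : List (Fin n × Bool)} :
    FreeGroup.IsReduced (l :: m :: w) ↔ Composable l m ∧ FreeGroup.IsReduced (m :: w) :=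
  List.isChain_cons_cons

/-- Lengths of images of reduced words under a minimal automorphism, with the control on the
cancellation against a further letter that makes the induction work. -/
theorem IsMinimal.norm_letter_mul {σ : MulAut (F n)} (hσ : IsMinimal σ) (l : Fin n × Bool)
    (w : List (Fin n × Bool)) (hw : FreeGroup.IsReduced (l :: w)) :
    (l :: w).length ≤ (σ (mk (l :: w))).norm ∧ ∀ m, Composable m l →
      (σ (mk [m]) * σ (mk (l :: w))).norm + (σ (mk [l])).norm =
        (σ (mk (l :: w))).norm + (σ (mk [m]) * σ (mk [l])).norm ∧
      2 * (l :: w).length + (σ (mk [l])).norm + (σ (mk [m])).norm ≤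
        2 * (σ (mk (l :: w))).norm + (σ (mk [m]) * σ (mk [l])).norm := by
  -- The last inequality says that at least as many letters of σ(lw) survive left multiplication by
  -- σ(m) as the word lw has.
  have hpos : ∀ m, 0 < (σ (mk [m])).norm := fun m =>
    Nat.pos_of_ne_zero fun h => letter_ne_one σ m (FreeGroup.norm_eq_zero.1 h)
  induction w generalizing l with
  | nil =>
    refine ⟨hpos l, fun m hm => ⟨by omega, ?_⟩⟩
    have h1 := hσ.norm_le_norm_mul hm
    obtain ⟨k, hk⟩ := norm_mul_parity (σ (mk [m])) (σ (mk [l]))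
    have := hpos l
    simp only [List.length_cons, List.length_nil]
    omega
  | cons r w ih =>
    obtain ⟨hlr, hw'⟩ := isReduced_cons_cons.1 hw
    obtain ⟨ih1, ih2⟩ := ih r hw'
    obtain ⟨ih3, ih4⟩ := ih2 l hlr
    have hmul : σ (mk (l :: r :: w)) = σ (mk [l]) * σ (mk (r :: w)) := by
      rw [← _root_.map_mul, mul_mk]; rfl
    rw [hmul]
    have h1 := hσ.norm_le_norm_mul hlr
    have hp := hpos l
    simp only [List.length_cons] at ih1 ih4 ⊢
    refine ⟨by omega, fun m hm => ?_⟩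
    have h2 := hσ.norm_add_norm_lt hm hlr
    -- Letters cancel in pairs, so by parity the strict inequality `h2` has a gap of at least 2;
    -- this pays for the additional letter.
    obtain ⟨k, hk⟩ := norm_mul_parity (σ (mk [m])) (σ (mk [l]))
    obtain ⟨k', hk'⟩ := norm_mul_parity (σ (mk [l])) (σ (mk [r]))
    have h3 := norm_mul_mul (σ (mk [m])) (σ (mk [l])) (σ (mk (r :: w))) (by omega)
    rw [mul_assoc] at h3
    exact ⟨by omega, by omega⟩

theorem IsMinimal.norm_le {σ : MulAut (F n)} (hσ : IsMinimal σ) (g : F n) :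
    g.norm ≤ (σ g).norm := by
  have key : ∀ w : List (Fin n × Bool), FreeGroup.IsReduced w → w.length ≤ (σ (mk w)).norm := by
    intro w hw
    cases w with
    | nil => simp
    | cons l w => exact (hσ.norm_letter_mul l w hw).1
  have h := key g.toWord isReduced_toWord
  rwa [mk_toWord] at h

/-- As σ shortens no word, the preimage of a generator has length at most 1, so σ⁻¹ is a signed
permutation. -/
theorem IsMinimal.mem_nielsen {σ : MulAut (F n)} (hσ : IsMinimal σ) : σ ∈ nielsen n := by
  rw [← inv_mem_iff]
  refine mem_nielsen_of_letters _ fun k => ?_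
  have h := hσ.norm_le (σ⁻¹ (of k))
  rw [MulAut.apply_inv_self, norm_of] at h
  obtain ⟨l, hl⟩ : ∃ l, (σ⁻¹ (of k)).toWord = [l] := by
    rw [← List.length_eq_one_iff]
    refine le_antisymm h (Nat.pos_of_ne_zero fun h0 => ?_)
    rw [List.length_eq_zero_iff, toWord_eq_nil_iff, EmbeddingLike.map_eq_one_iff] at h0
    exact of_ne_one k h0
  exact ⟨l, by rw [← hl, mk_toWord]⟩

/-- **Nielsen's theorem**: `Aut F_n` is generated by the elementary Nielsen automorphisms. -/
theorem nielsen_eq_top (n : ℕ) : nielsen n = ⊤ := by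
  rw [eq_top_iff]
  intro σ _
  obtain ⟨τ, hτ, hmin⟩ := exists_isMinimal σ
  exact (Subgroup.mul_mem_cancel_right _ hτ).1 hmin.mem_nielsen

end Minimal

/-! ### The standard basis of H -/

section Basis

variable (n : ℕ)

/-- The basis of `H` given by the classes of the generators. -/
def hBasis : Module.Basis (Fin n) ℤ (H n) := FreeAbelianGroup.basis (Fin n)

/-- The class of a word in `H`. -/
def cls (w : F n) : H n := Additive.ofMul (Abelianization.of w)

variable {n}

theorem hBasis_apply (i : Fin n) : hBasis n i = cls n (of i) := by
  change (FreeAbelianGroup.equivFinsupp (Fin n)).symm (Finsupp.single i 1) = FreeAbelianGroup.of i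
  rw [AddEquiv.symm_apply_eq]
  exact (FreeAbelianGroup.toFinsupp_of i).symm

theorem cls_mul (u v : F n) : cls n (u * v) = cls n u + cls n v := rfl

theorem cls_inv (u : F n) : cls n u⁻¹ = -cls n u := rfl

theorem abRep_cls (σ : MulAut (F n)) (w : F n) : abRep (F n) σ (cls n w) = cls n (σ w) := rfl

end Basis

/-! ### Fox calculus and Morita's crossed homomorphism -/

section Fox

variable {n : ℕ}

/-- The class of a word in `ℤ[H]`. -/
def grp (n : ℕ) : F n →* MonoidAlgebra ℤ (HMul n) :=
  (MonoidAlgebra.of ℤ (HMul n)).comp Abelianization.of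

/-- The abelianized Fox derivative of a word. -/
def foxAb (j : Fin n) (w : F n) : MonoidAlgebra ℤ (HMul n) := abRing n (foxWord n j w)

theorem magnus_apply (σ : MulAut (F n)) (i j : Fin n) :
    magnus n σ i j = foxAb j (σ (of i)) := by
  simp [magnus, foxAb, foxDeriv]

theorem abRing_of (w : F n) : abRing n (MonoidAlgebra.of ℤ (F n) w) = grp n w := by
  simp [abRing, grp]

theorem foxAb_of (i j : Fin n) : foxAb j (of i) = if i = j then 1 else 0 := by
  rw [foxAb, foxWord_of]
  split_ifs <;> simp

theorem foxAb_mul (j : Fin n) (u v : F n) : foxAb j (u * v) = foxAb j u + grp n u * foxAb j v := by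
  rw [foxAb, foxWord_mul, map_add, _root_.map_mul, abRing_of]
  rfl

theorem crossed_one {R : Type*} [Ring R] {φ : F n →* R} {c : F n → R}
    (hc : ∀ u v, c (u * v) = c u + φ u * c v) : c 1 = 0 := by
  simpa using hc 1 1

theorem crossed_inv {R : Type*} [Ring R] {φ : F n →* R} {c : F n → R}
    (hc : ∀ u v, c (u * v) = c u + φ u * c v) (u : F n) : c u⁻¹ = -(φ u⁻¹ * c u) := by
  have h := hc u⁻¹ u
  rw [inv_mul_cancel, crossed_one hc] at h
  exact eq_neg_of_add_eq_zero_left h.symm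

/-- Derivations of the free group agree if they agree on the generators. -/
theorem crossed_ext {R : Type*} [Ring R] {φ : F n →* R} {c d : F n → R}
    (hc : ∀ u v, c (u * v) = c u + φ u * c v) (hd : ∀ u v, d (u * v) = d u + φ u * d v)
    (h : ∀ i, c (of i) = d (of i)) (w : F n) : c w = d w := by
  induction w using FreeGroup.induction_on with
  | C1 => rw [crossed_one hc, crossed_one hd]
  | of i => exact h i
  | inv_of i hi =>
    rw [crossed_inv hc, crossed_inv hd]
    exact congrArg (fun x => -(φ (of i)⁻¹ * x)) hi
  | mul u v hu hv => rw [hc, hd, hu, hv]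

theorem foxAb_inv_of (i j : Fin n) :
    foxAb j (of i)⁻¹ = if i = j then -grp n (of i)⁻¹ else 0 := by
  rw [crossed_inv (foxAb_mul j), foxAb_of]
  split_ifs <;> simp

/-- The action of `Aut F_n` on `ℤ[H]`. -/
def actRing (σ : MulAut (F n)) : MonoidAlgebra ℤ (HMul n) →+* MonoidAlgebra ℤ (HMul n) :=
  MonoidAlgebra.mapDomainRingHom ℤ (Abelianization.map (σ : F n →* F n))

theorem actRing_grp (σ : MulAut (F n)) (w : F n) : actRing σ (grp n w) = grp n (σ w) := by
  simp [actRing, grp]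

theorem actRing_of (σ : MulAut (F n)) (h : H n) :
    actRing σ (MonoidAlgebra.of ℤ (HMul n) h.toMul) =
      MonoidAlgebra.of ℤ (HMul n) (abRep (F n) σ h).toMul := by
  simp [actRing, abRep]

/-- The chain rule for abelianized Fox derivatives. -/
theorem foxAb_apply (σ : MulAut (F n)) (j : Fin n) (w : F n) :
    foxAb j (σ w) = ∑ k, actRing σ (foxAb k w) * foxAb j (σ (of k)) := by
  refine crossed_ext (φ := (grp n).comp (σ : F n →* F n)) (c := fun w => foxAb j (σ w))
    (d := fun w => ∑ k, actRing σ (foxAb k w) * foxAb j (σ (of k))) ?_ ?_ ?_ w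
  · intro u v
    simp only [_root_.map_mul, foxAb_mul]
    rfl
  · intro u v
    simp only [foxAb_mul, map_add, _root_.map_mul, actRing_grp, add_mul, Finset.sum_add_distrib,
      Finset.mul_sum, mul_assoc]
    rfl
  · intro i
    simp [foxAb_of]

theorem magnus_mul (σ τ : MulAut (F n)) :
    magnus n (σ * τ) = (actRing σ).mapMatrix (magnus n τ) * magnus n σ := by
  ext1 i j
  rw [Matrix.mul_apply, magnus_apply, MulAut.mul_apply, foxAb_apply]
  simp [magnus_apply]

theorem moritaElt_mul (σ τ : MulAut (F n)) :
    moritaElt n (σ * τ) = actRing σ (moritaElt n τ) * moritaElt n σ := by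
  simp only [moritaElt, sgn, magnus_mul, Matrix.det_mul, _root_.map_mul, map_zsmul,
    RingHom.map_det, smul_mul_smul_comm]
  rw [mul_comm (LinearMap.det (abRep (F n) σ))]

theorem moritaElt_one : moritaElt n 1 = 1 := by
  have : magnus n 1 = 1 := by
    ext1 i j
    rw [magnus_apply, MulAut.one_apply, foxAb_of, Matrix.one_apply]
  simp [moritaElt, sgn, this]

theorem toMatrix_abRep (σ : MulAut (F n)) (i j : Fin n) :
    LinearMap.toMatrix (hBasis n) (hBasis n) (abRep (F n) σ) i j =
      (hBasis n).repr (cls n (σ (of j))) i := by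
  rw [LinearMap.toMatrix_apply, hBasis_apply, abRep_cls]

theorem sgn_inversion (i : Fin n) : sgn n (inversion i) = -1 := by
  have : LinearMap.toMatrix (hBasis n) (hBasis n) (abRep (F n) (inversion i)) =
      Matrix.diagonal (Function.update 1 i (-1)) := by
    ext l j
    rw [toMatrix_abRep]
    by_cases h : j = i
    · subst h
      rw [inversion_of_self, cls_inv, ← hBasis_apply]
      by_cases hl : l = j
      · subst hl; simp
      · simp [hl]
    · rw [inversion_of_ne h, ← hBasis_apply]
      by_cases hl : l = j
      · subst hl; simp [h]
      · simp [hl]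
  rw [sgn, ← LinearMap.det_toMatrix (hBasis n), this, Matrix.det_diagonal,
    Finset.prod_update_of_mem (Finset.mem_univ i)]
  simp

theorem sgn_transvection {i j : Fin n} (hij : i ≠ j) : sgn n (transvection i j hij) = 1 := by
  have : LinearMap.toMatrix (hBasis n) (hBasis n) (abRep (F n) (transvection i j hij)) =
      Matrix.transvection j i 1 := by
    ext l m
    rw [toMatrix_abRep]
    by_cases h : m = i
    · subst h
      rw [transvection_of_self, cls_mul, ← hBasis_apply, ← hBasis_apply]
      simp [Matrix.transvection, Matrix.one_apply, Matrix.single_apply, Finsupp.single_apply,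
        eq_comm]
    · rw [transvection_of_ne hij h, ← hBasis_apply]
      simp [Matrix.transvection, Matrix.one_apply, Finsupp.single_apply, eq_comm, Ne.symm h]
  rw [sgn, ← LinearMap.det_toMatrix (hBasis n), this, Matrix.det_transvection_of_ne _ _ hij.symm]

/-- The Magnus determinant is -x_i⁻¹, only a unit up to sign; the factor sgn = -1 makes it an
element of H. -/
theorem moritaElt_inversion (i : Fin n) :
    moritaElt n (inversion i) = MonoidAlgebra.of ℤ (HMul n) (-hBasis n i).toMul := by
  have : magnus n (inversion i) = Matrix.diagonal (Function.update 1 i (-grp n (of i)⁻¹)) := by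
    ext1 l j
    rw [magnus_apply]
    by_cases h : l = i
    · subst h
      rw [inversion_of_self, foxAb_inv_of]
      by_cases hl : l = j
      · subst hl; simp
      · simp [hl]
    · rw [inversion_of_ne h, foxAb_of]
      by_cases hl : l = j
      · subst hl; simp [h]
      · simp [hl]
  rw [moritaElt, sgn_inversion, this, Matrix.det_diagonal,
    Finset.prod_update_of_mem (Finset.mem_univ i), hBasis_apply]
  simp only [Pi.one_apply, Finset.prod_const_one, mul_one, neg_smul, one_smul, neg_neg]
  rfl

theorem moritaElt_transvection {i j : Fin n} (hij : i ≠ j) :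
    moritaElt n (transvection i j hij) = MonoidAlgebra.of ℤ (HMul n) (0 : H n).toMul := by
  have : magnus n (transvection i j hij) = Matrix.transvection i j (grp n (of i)) := by
    ext1 l m
    rw [magnus_apply]
    by_cases h : l = i
    · subst h
      rw [transvection_of_self, foxAb_mul, foxAb_of, foxAb_of]
      simp [Matrix.transvection, Matrix.one_apply, Matrix.single_apply]
    · rw [transvection_of_ne hij h, foxAb_of]
      simp [Matrix.transvection, Matrix.one_apply, Ne.symm h]
  rw [moritaElt, sgn_transvection, this, Matrix.det_transvection_of_ne _ _ hij]
  simp [MonoidAlgebra.one_def]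

/-- By the crossed product law, the automorphisms with value in H form a subgroup, so Nielsen
generators suffice. -/
theorem exists_moritaElt_eq (σ : MulAut (F n)) :
    ∃ h : H n, MonoidAlgebra.of ℤ (HMul n) h.toMul = moritaElt n σ := by
  have hσ : σ ∈ nielsen n := by rw [nielsen_eq_top]; trivial
  induction hσ using Subgroup.closure_induction with
  | mem x hx =>
    rcases hx with ⟨i, rfl⟩ | ⟨i, j, hij, rfl⟩
    · exact ⟨_, (moritaElt_inversion i).symm⟩
    · exact ⟨_, (moritaElt_transvection hij).symm⟩
  | one => exact ⟨0, by rw [moritaElt_one]; simp [MonoidAlgebra.one_def]⟩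
  | mul x y _ _ hx hy =>
    obtain ⟨a, ha⟩ := hx
    obtain ⟨b, hb⟩ := hy
    refine ⟨abRep (F n) x b + a, ?_⟩
    rw [moritaElt_mul, ← ha, ← hb, actRing_of, ← _root_.map_mul]
    rfl
  | inv x _ hx =>
    obtain ⟨a, ha⟩ := hx
    refine ⟨-abRep (F n) x⁻¹ a, ?_⟩
    have h := moritaElt_mul x⁻¹ x
    rw [inv_mul_cancel, moritaElt_one, ← ha, actRing_of] at h
    rw [← one_mul (moritaElt n x⁻¹), ← _root_.map_one (MonoidAlgebra.of ℤ (HMul n)),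
      ← inv_mul_cancel (abRep (F n) x⁻¹ a).toMul, _root_.map_mul, mul_assoc, ← h, mul_one]
    rfl

/-- Morita's crossed homomorphism on `Aut F_n`, as a function. -/
def moritaFun (σ : MulAut (F n)) : H n := (exists_moritaElt_eq σ).choose

theorem of_moritaFun (σ : MulAut (F n)) :
    MonoidAlgebra.of ℤ (HMul n) (moritaFun σ).toMul = moritaElt n σ :=
  (exists_moritaElt_eq σ).choose_spec

theorem of_toMul_injective {a b : H n}
    (h : MonoidAlgebra.of ℤ (HMul n) a.toMul = MonoidAlgebra.of ℤ (HMul n) b.toMul) : a = b :=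
  Additive.toMul.injective (MonoidAlgebra.of_injective h)

theorem moritaFun_mul (σ τ : MulAut (F n)) :
    moritaFun (σ * τ) = abRep (F n) σ (moritaFun τ) + moritaFun σ := by
  apply of_toMul_injective
  rw [of_moritaFun, moritaElt_mul, ← of_moritaFun, ← of_moritaFun, actRing_of, ← _root_.map_mul]
  rfl

theorem moritaFun_inversion (i : Fin n) : moritaFun (inversion i) = -hBasis n i :=
  of_toMul_injective ((of_moritaFun _).trans (moritaElt_inversion i))

theorem moritaFun_transvection {i j : Fin n} (hij : i ≠ j) :
    moritaFun (transvection i j hij) = 0 :=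
  of_toMul_injective ((of_moritaFun _).trans (moritaElt_transvection hij))

/-- Morita's crossed homomorphism on `Aut F_n`. -/
def moritaCocycle (n : ℕ) : groupCohomology.cocycles₁ (autH n) :=
  ⟨moritaFun, (groupCohomology.mem_cocycles₁_iff _).2 moritaFun_mul⟩

end Fox

/-! ### Vanishing of f_M on the kernel of ρ_k -/

section Descent

variable {n : ℕ}

/-- The multiplicative map `H → ℤ[ε]`, `h ↦ 1 + h_i ε`, given by the `i`-th coordinate. -/
def dualHom (i : Fin n) : HMul n →* DualNumber ℤ where
  toFun h := 1 + TrivSqZeroExt.inr ((hBasis n).repr (Additive.ofMul h) i)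
  map_one' := by simp
  map_mul' x y := by ext <;> simp [add_comm]

/-- The ring homomorphism `ℤ[H] → ℤ[ε]` induced by `dualHom`. -/
def dualRing (i : Fin n) : MonoidAlgebra ℤ (HMul n) →+* DualNumber ℤ :=
  (MonoidAlgebra.lift ℤ (DualNumber ℤ) (HMul n) (dualHom i) : _ →ₐ[ℤ] DualNumber ℤ)

theorem dualRing_of (i : Fin n) (h : H n) :
    dualRing i (MonoidAlgebra.of ℤ (HMul n) h.toMul) =
      1 + TrivSqZeroExt.inr ((hBasis n).repr h i) := by
  simp [dualRing, dualHom]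

theorem fst_dualRing_grp (i : Fin n) (w : F n) : (dualRing i (grp n w)).fst = 1 :=
  (congrArg TrivSqZeroExt.fst (dualRing_of i (cls n w))).trans (by simp)

theorem dualRing_grp_of_mem (i : Fin n) {w : F n} (hw : w ∈ commutator (F n)) :
    dualRing i (grp n w) = 1 := by
  rw [← Abelianization.ker_of, MonoidHom.mem_ker] at hw
  rw [grp, MonoidHom.comp_apply, hw, _root_.map_one, _root_.map_one]

/-- The augmented Fox derivative is a homomorphism to ℤ, so it kills commutators. -/
theorem fst_dualRing_foxAb_of_mem (i j : Fin n) {w : F n} (hw : w ∈ commutator (F n)) :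
    (dualRing i (foxAb j w)).fst = 0 := by
  let φ : F n →* Multiplicative ℤ := MonoidHom.mk'
    (fun w => Multiplicative.ofAdd (dualRing i (foxAb j w)).fst) (fun u v => by
      rw [foxAb_mul, map_add, _root_.map_mul, TrivSqZeroExt.fst_add, TrivSqZeroExt.fst_mul,
        fst_dualRing_grp, one_mul]
      rfl)
  exact Abelianization.commutator_subset_ker φ hw

theorem dualRing_foxAb_mul (i j : Fin n) (u v : F n) : dualRing i (foxAb j (u * v)) =
    dualRing i (foxAb j u) + dualRing i (grp n u) * dualRing i (foxAb j v) := by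
  rw [foxAb_mul, map_add, _root_.map_mul]

/-- Fox derivatives of elements of `Γ_n(3)` vanish to second order. -/
theorem dualRing_foxAb_of_mem_lcs (i j : Fin n) {w : F n} (hw : w ∈ lcs n 2) :
    dualRing i (foxAb j w) = 0 := by
  let S : Subgroup (F n) :=
    { carrier := {w | w ∈ commutator (F n) ∧ dualRing i (foxAb j w) = 0}
      one_mem' := ⟨one_mem _, by rw [crossed_one (foxAb_mul j), map_zero]⟩
      mul_mem' := by
        rintro u v ⟨hu, hu'⟩ ⟨hv, hv'⟩
        refine ⟨mul_mem hu hv, ?_⟩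
        rw [dualRing_foxAb_mul, hu', hv', mul_zero, add_zero]
      inv_mem' := by
        rintro u ⟨hu, hu'⟩
        refine ⟨inv_mem hu, ?_⟩
        rw [crossed_inv (foxAb_mul j), map_neg, _root_.map_mul, hu', mul_zero, neg_zero] }
  suffices h : lcs n 2 ≤ S from (h hw).2
  have h1 : lcs n 1 = commutator (F n) := Subgroup.top_lowerCentralSeries_one
  change ⁅lcs n 1, ⊤⁆ ≤ S
  rw [h1, Subgroup.commutator_le]
  intro c hc u _
  have hcu : ⁅c, u⁆ ∈ commutator (F n) := Subgroup.commutator_mem_commutator trivial trivial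
  refine ⟨hcu, ?_⟩
  -- Differentiating [c, u] u c = c u, with c and [c, u] trivial in H, gives ∂[c, u] = (1 - u) ∂c.
  -- Both factors have zero constant part, so the product dies by ε² = 0.
  have h2 := dualRing_foxAb_mul i j ⁅c, u⁆ (u * c)
  rw [show ⁅c, u⁆ * (u * c) = c * u by rw [commutatorElement_def]; group, dualRing_foxAb_mul,
    dualRing_foxAb_mul, dualRing_grp_of_mem i hc, dualRing_grp_of_mem i hcu] at h2
  have h3 : (1 - dualRing i (grp n u)) * dualRing i (foxAb j c) = 0 := by
    have hf := fst_dualRing_foxAb_of_mem i j hc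
    have hg := fst_dualRing_grp i u
    ext <;> simp [hf, hg]
  linear_combination -h2 + h3

theorem moritaFun_eq_zero {k : ℕ} (hk : 2 ≤ k) {σ : MulAut (F n)} (hσ : rho n k σ = 1) :
    moritaFun σ = 0 := by
  have hmem : ∀ i, (of i)⁻¹ * σ (of i) ∈ lcs n 2 := by
    intro i
    have h : (QuotientGroup.mk (σ (of i)) : N n k) = QuotientGroup.mk (of i) :=
      DFunLike.congr_fun hσ (QuotientGroup.mk (of i) : N n k)
    exact Subgroup.lowerCentralSeries_antitone _ hk (QuotientGroup.eq.1 h.symm)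
  refine (hBasis n).repr.map_eq_zero_iff.1 (Finsupp.ext fun i => ?_)
  have hmag : (dualRing i).mapMatrix (magnus n σ) = 1 := by
    ext1 l j
    rw [RingHom.mapMatrix_apply, Matrix.map_apply, magnus_apply,
      ← mul_inv_cancel_left (of l) (σ (of l)), dualRing_foxAb_mul,
      dualRing_foxAb_of_mem_lcs i j (hmem l), mul_zero, add_zero, foxAb_of, Matrix.one_apply]
    split_ifs <;> simp
  have h := dualRing_of i (moritaFun σ)
  rw [of_moritaFun, moritaElt, map_zsmul, RingHom.map_det, hmag, Matrix.det_one] at h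
  -- The determinant is now 1 and the sign is an integer, so the ε-part, which is the `i`-th
  -- coordinate, vanishes.
  have h2 := congrArg TrivSqZeroExt.snd h
  simpa using h2.symm

end Descent

/-! ### Crossed homomorphisms on Aut F_n up to principal ones -/

section Crossed

variable {n : ℕ}

/-- Crossed homomorphisms `Aut F_n → H`. -/
def IsCrossed (φ : MulAut (F n) → H n) : Prop :=
  ∀ σ τ, φ (σ * τ) = abRep (F n) σ (φ τ) + φ σ

theorem IsCrossed.map_one {φ : MulAut (F n) → H n} (hφ : IsCrossed φ) : φ 1 = 0 := by
  simpa using hφ 1 1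

theorem isCrossed_moritaFun : IsCrossed (moritaFun (n := n)) := moritaFun_mul

theorem isCrossed_principal (h : H n) : IsCrossed fun σ => abRep (F n) σ h - h := by
  intro σ τ
  simp [map_sub]

theorem IsCrossed.sub_smul {φ ψ : MulAut (F n) → H n} (hφ : IsCrossed φ) (hψ : IsCrossed ψ)
    (m : ℤ) : IsCrossed fun σ => φ σ - m • ψ σ := by
  intro σ τ
  simp only [hφ σ τ, hψ σ τ, map_sub, map_zsmul, smul_add]
  abel

theorem IsCrossed.ext {φ ψ : MulAut (F n) → H n} (hφ : IsCrossed φ) (hψ : IsCrossed ψ)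
    (h1 : ∀ i, φ (inversion i) = ψ (inversion i))
    (h2 : ∀ i j (hij : i ≠ j), φ (transvection i j hij) = ψ (transvection i j hij))
    (σ : MulAut (F n)) : φ σ = ψ σ := by
  have hσ : σ ∈ nielsen n := by rw [nielsen_eq_top]; trivial
  induction hσ using Subgroup.closure_induction with
  | mem x hx =>
    rcases hx with ⟨i, rfl⟩ | ⟨i, j, hij, rfl⟩
    · exact h1 i
    · exact h2 i j hij
  | one => rw [hφ.map_one, hψ.map_one]
  | mul x y _ _ hx hy => rw [hφ, hψ, hx, hy]
  | inv x _ hx =>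
    have h3 := hφ x⁻¹ x
    have h4 := hψ x⁻¹ x
    rw [inv_mul_cancel, hφ.map_one, hx] at h3
    rw [inv_mul_cancel, hψ.map_one] at h4
    exact add_left_cancel (h3.symm.trans h4)

/-- The `l`-th coordinate of an element of `H`. -/
def co (l : Fin n) : H n →ₗ[ℤ] ℤ := (hBasis n).coord l

theorem co_ext {x y : H n} (h : ∀ l, co l x = co l y) : x = y :=
  (hBasis n).ext_elem h

theorem co_hBasis (l i : Fin n) : co l (hBasis n i) = if i = l then 1 else 0 := by
  simp [co, Finsupp.single_apply]

theorem co_inversion (i l : Fin n) (h : H n) :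
    co l (abRep (F n) (inversion i) h) = if l = i then -co l h else co l h := by
  have : (hBasis n).coord l ∘ₗ abRep (F n) (inversion i) =
      if l = i then -(hBasis n).coord l else (hBasis n).coord l := by
    refine (hBasis n).ext fun m => ?_
    rw [LinearMap.comp_apply, hBasis_apply, abRep_cls]
    by_cases hm : m = i
    · subst hm
      rw [inversion_of_self, cls_inv, ← hBasis_apply]
      by_cases hl : l = m
      · simp [hl]
      · simp [hl]
    · rw [inversion_of_ne hm, ← hBasis_apply]
      by_cases hl : l = i
      · subst hl; simp [hm]
      · simp [hl]
  have h2 := LinearMap.congr_fun this h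
  split_ifs at h2 ⊢ <;> exact h2

theorem co_transvection {i j : Fin n} (hij : i ≠ j) (l : Fin n) (h : H n) :
    co l (abRep (F n) (transvection i j hij) h) = co l h + if l = j then co i h else 0 := by
  have : (hBasis n).coord l ∘ₗ abRep (F n) (transvection i j hij) =
      (hBasis n).coord l + if l = j then (hBasis n).coord i else 0 := by
    refine (hBasis n).ext fun m => ?_
    rw [LinearMap.comp_apply, hBasis_apply, abRep_cls]
    by_cases hm : m = i
    · subst hm
      rw [transvection_of_self, cls_mul, ← hBasis_apply, ← hBasis_apply]
      by_cases hl : l = j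
      · simp [hl]
      · simp [hl]
    · rw [transvection_of_ne hij hm, ← hBasis_apply]
      by_cases hl : l = j
      · simp [hl, Finsupp.single_apply, hm]
      · simp [hl]
  have h2 := LinearMap.congr_fun this h
  split_ifs at h2 ⊢ <;> exact h2

/-- The automorphism `x_i ↦ x_j⁻¹ x_i x_j` fixing the other generators. -/
def partialConj (i j : Fin n) (hij : i ≠ j) : MulAut (F n) :=
  transvection i j hij * inversion i * transvection i j hij * inversion i

theorem partialConj_of_self {i j : Fin n} (hij : i ≠ j) :
    partialConj i j hij (of i) = (of j)⁻¹ * of i * of j := by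
  simp [partialConj, hij.symm, mul_assoc]

theorem partialConj_of_ne {i j l : Fin n} (hij : i ≠ j) (h : l ≠ i) :
    partialConj i j hij (of l) = of l := by
  simp [partialConj, h]

theorem abRep_partialConj {i j : Fin n} (hij : i ≠ j) (h : H n) :
    abRep (F n) (partialConj i j hij) h = h := by
  have : abRep (F n) (partialConj i j hij) = LinearMap.id := by
    refine (hBasis n).ext fun l => ?_
    rw [hBasis_apply, abRep_cls, LinearMap.id_apply]
    by_cases hl : l = i
    · subst hl
      rw [partialConj_of_self, cls_mul, cls_mul, cls_inv]
      abel
    · rw [partialConj_of_ne hij hl]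
  rw [this, LinearMap.id_apply]

theorem inversion_mul_partialConj {i j l : Fin n} (hij : i ≠ j) (hl : l ≠ j) :
    inversion l * partialConj i j hij = partialConj i j hij * inversion l := by
  apply mulAut_ext
  intro m
  simp only [MulAut.mul_apply]
  by_cases hm : m = i
  · subst hm
    by_cases hml : l = m
    · subst hml
      simp [partialConj_of_self, inversion_of_ne hl.symm, mul_assoc]
    · simp [partialConj_of_self, inversion_of_ne hl.symm, inversion_of_ne (Ne.symm hml)]
  · by_cases hml : m = l
    · subst hml
      simp [partialConj_of_ne hij hm]
    · simp [partialConj_of_ne hij hm, hml]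

theorem permAut_mul_partialConj (e : Equiv.Perm (Fin n)) {i j : Fin n} (hij : i ≠ j) :
    permAut e * partialConj i j hij =
      partialConj (e i) (e j) (e.injective.ne hij) * permAut e := by
  apply mulAut_ext
  intro m
  simp only [MulAut.mul_apply, permAut_of]
  by_cases hm : m = i
  · subst hm
    simp [partialConj_of_self]
  · simp [partialConj_of_ne hij hm, partialConj_of_ne _ (e.injective.ne hm)]

theorem inversion_transvection_relation {i j : Fin n} (hij : i ≠ j) :
    inversion j * transvection i j hij * inversion j * transvection i j hij = 1 := by
  apply mulAut_ext
  intro m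
  by_cases hm : m = i
  · subst hm
    simp [hij, hij.symm]
  · by_cases hmj : m = j
    · subst hmj
      simp [hm]
    · simp [hm, hmj]

namespace IsCrossed

variable {φ : MulAut (F n) → H n}

/-- The commutation relation and the trivial action of K_ij on H make φ(K_ij) invariant under the
inversion of x_l, which negates the `l`-th coordinate. -/
theorem co_partialConj_of_ne (hφ : IsCrossed φ) {i j l : Fin n} (hij : i ≠ j) (hl : l ≠ j) :
    co l (φ (partialConj i j hij)) = 0 := by
  have h := congrArg φ (inversion_mul_partialConj hij hl)
  rw [hφ, hφ, abRep_partialConj, add_comm, add_left_cancel_iff] at h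
  have h2 := congrArg (co l) h
  rw [co_inversion, if_pos rfl] at h2
  omega

theorem partialConj_permAut (hφ : IsCrossed φ) (e : Equiv.Perm (Fin n)) {i j : Fin n}
    (hij : i ≠ j) : φ (partialConj (e i) (e j) (e.injective.ne hij)) =
      abRep (F n) (permAut e) (φ (partialConj i j hij)) := by
  have h := congrArg φ (permAut_mul_partialConj e hij)
  rw [hφ, hφ, abRep_partialConj, add_comm, add_left_cancel_iff] at h
  exact h.symm

theorem partialConj_eq_zero (hφ : IsCrossed φ) {i j : Fin n} (hij : i ≠ j)
    (h : co j (φ (partialConj i j hij)) = 0) {i' j' : Fin n} (hij' : i' ≠ j') :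
    φ (partialConj i' j' hij') = 0 := by
  have h0 : φ (partialConj i j hij) = 0 := by
    refine co_ext fun l => ?_
    rw [map_zero]
    by_cases hl : l = j
    · rw [hl, h]
    · exact hφ.co_partialConj_of_ne hij hl
  -- A permutation taking the ordered pair (i, j) to (i', j').
  let e : Equiv.Perm (Fin n) := Equiv.swap (Equiv.swap i i' j) j' * Equiv.swap i i'
  have hi : e i = i' := by
    have : i' ≠ Equiv.swap i i' j := by
      intro h
      have := (Equiv.swap i i').injective ((Equiv.swap_apply_left i i').trans h)
      exact hij this
    simp [e, Equiv.swap_apply_of_ne_of_ne this hij']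
  have hj : e j = j' := by simp [e]
  have h2 := hφ.partialConj_permAut e hij
  rw [h0, map_zero] at h2
  simpa only [hi, hj] using h2

theorem co_inversion_of_ne (hφ : IsCrossed φ) {i l : Fin n} (hl : l ≠ i) :
    co l (φ (inversion i)) = 0 := by
  have h := hφ (inversion i) (inversion i)
  rw [inversion_mul_self, hφ.map_one] at h
  have h2 := congrArg (co l) h
  rw [map_zero, map_add, co_inversion, if_neg hl] at h2
  omega

/-- The relation between the transvection and the inversion of x_j kills the `i`-th coordinate. The
others come from expanding φ(K_ij) = 0 along its defining product. -/
theorem transvection_of_partialConj (hφ : IsCrossed φ) {i j : Fin n} (hij : i ≠ j)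
    (h : φ (partialConj i j hij) = 0) :
    (∀ l, l ≠ j → co l (φ (transvection i j hij)) = 0) ∧
      co i (φ (inversion i)) = -2 * co j (φ (transvection i j hij)) := by
  have h1 := congrArg φ (inversion_transvection_relation hij)
  rw [hφ, hφ, hφ, hφ.map_one] at h1
  have hi := congrArg (co i) h1
  rw [partialConj, hφ, hφ, hφ] at h
  simp only [map_add, map_zero, co_inversion, co_transvection, hij, ↓reduceIte, _root_.map_mul,
    Module.End.mul_apply, hφ.co_inversion_of_ne hij] at hi
  have hi0 : co i (φ (transvection i j hij)) = 0 := by omega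
  have hj := congrArg (co j) h
  simp only [map_add, map_zero, co_inversion, co_transvection, hij, hij.symm, ↓reduceIte,
    _root_.map_mul, Module.End.mul_apply, hφ.co_inversion_of_ne hij.symm, hi0] at hj
  refine ⟨fun l hl => ?_, by omega⟩
  by_cases hli : l = i
  · rw [hli, hi0]
  have hl' := congrArg (co l) h
  simp only [map_add, map_zero, co_inversion, co_transvection, hl, hli, ↓reduceIte,
    _root_.map_mul, Module.End.mul_apply, hφ.co_inversion_of_ne hli] at hl'
  omega

/-- A crossed homomorphism that vanishes on the partial conjugations is principal. -/
theorem exists_principal (hn : 2 ≤ n) (hφ : IsCrossed φ)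
    (h : ∀ i j (hij : i ≠ j), φ (partialConj i j hij) = 0) :
    ∃ x : H n, ∀ σ, φ σ = abRep (F n) σ x - x := by
  have hex : ∀ i : Fin n, ∃ c : ℤ, co i (φ (inversion i)) = -2 * c := fun i => by
    have : Nontrivial (Fin n) := Fin.nontrivial_iff_two_le.2 hn
    obtain ⟨j, hj⟩ := exists_ne i
    exact ⟨_, (hφ.transvection_of_partialConj hj.symm (h i j hj.symm)).2⟩
  choose c hc using hex
  -- The inversion of x_i moves x by -2 c_i times the i-th basis vector, which forces the
  -- coefficients; a transvection x_i ↦ x_i x_j then moves x by c_i times the j-th.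
  let x : H n := ∑ i, c i • hBasis n i
  have hx : ∀ l, co l x = c l := fun l => by
    simp [x, co, Finsupp.single_apply]
  refine ⟨x, hφ.ext (isCrossed_principal x) (fun i => ?_) (fun i j hij => ?_)⟩
  · refine co_ext fun l => ?_
    rw [map_sub, co_inversion]
    by_cases hl : l = i
    · subst hl
      rw [if_pos rfl, hc, hx]
      ring
    · rw [if_neg hl, hφ.co_inversion_of_ne hl, sub_self]
  · obtain ⟨h1, h2⟩ := hφ.transvection_of_partialConj hij (h i j hij)
    refine co_ext fun l => ?_
    rw [map_sub, co_transvection]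
    by_cases hl : l = j
    · subst hl
      rw [if_pos rfl, hx, hx]
      rw [hc] at h2
      omega
    · rw [if_neg hl, h1 l hl]
      ring

end IsCrossed

theorem moritaFun_partialConj {i j : Fin n} (hij : i ≠ j) :
    co j (moritaFun (partialConj i j hij)) = -1 := by
  rw [partialConj, moritaFun_mul, moritaFun_mul, moritaFun_mul, moritaFun_inversion,
    moritaFun_transvection]
  simp [co_inversion, co_transvection, hij, hij.symm, co_hBasis]

/-- Every crossed homomorphism is, up to a principal one, a multiple of Morita's. -/
theorem IsCrossed.exists_eq_smul_moritaFun_add (hn : 2 ≤ n) {φ : MulAut (F n) → H n}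
    (hφ : IsCrossed φ) :
    ∃ (m : ℤ) (x : H n), ∀ σ, φ σ = m • moritaFun σ + (abRep (F n) σ x - x) := by
  have h01 : (⟨0, by omega⟩ : Fin n) ≠ ⟨1, by omega⟩ := by simp
  -- The sign compensates for the value -1 of Morita's crossed homomorphism.
  let m := -co ⟨1, by omega⟩ (φ (partialConj _ _ h01))
  have hψ := hφ.sub_smul isCrossed_moritaFun m
  obtain ⟨x, hx⟩ := hψ.exists_principal hn fun i j hij => hψ.partialConj_eq_zero h01 (by
    rw [map_sub, map_zsmul, moritaFun_partialConj]
    simp [m]) hij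
  exact ⟨m, x, fun σ => by rw [← hx]; abel⟩

/-- Evaluate on a partial conjugation, where principal crossed homomorphisms vanish. -/
theorem moritaFun_not_principal (hn : 2 ≤ n) {m : ℤ} {x : H n}
    (h : ∀ σ : MulAut (F n), m • moritaFun σ = abRep (F n) σ x - x) : m = 0 := by
  have h01 : (⟨0, by omega⟩ : Fin n) ≠ ⟨1, by omega⟩ := by simp
  have h2 := congrArg (co ⟨1, by omega⟩) (h (partialConj _ _ h01))
  rw [abRep_partialConj, sub_self, map_zsmul, moritaFun_partialConj, map_zero] at h2
  simpa using h2

end Crossed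

/-! ### Passage to the tame automorphism group -/

section Tame

variable {n k : ℕ}

theorem proj_surjective (n k : ℕ) : Function.Surjective (proj n k) :=
  (rho n k).rangeRestrict_surjective

/-- Morita's crossed homomorphism on `T_{n,k}`, as a function. -/
def tameFun (n k : ℕ) (g : T n k) : H n := moritaFun (proj_surjective n k g).choose

/-- Two lifts differ by an element of the kernel of ρ_k, where f_M vanishes, so the chosen lift is
immaterial. -/
theorem tameFun_proj (hk : 2 ≤ k) (σ : MulAut (F n)) : tameFun n k (proj n k σ) = moritaFun σ := by
  have h := (proj_surjective n k (proj n k σ)).choose_spec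
  rw [tameFun]
  generalize (proj_surjective n k (proj n k σ)).choose = τ at h ⊢
  have h1 : rho n k (σ⁻¹ * τ) = 1 := by
    have : rho n k τ = rho n k σ := congrArg Subtype.val h
    rw [_root_.map_mul, this, ← _root_.map_mul, inv_mul_cancel, _root_.map_one]
  have h2 := moritaFun_mul σ (σ⁻¹ * τ)
  rwa [mul_inv_cancel_left, moritaFun_eq_zero hk h1, map_zero, zero_add] at h2

/-- Morita's crossed homomorphism on `T_{n,k}`. -/
def tameCocycle (n k : ℕ) (hk : 2 ≤ k) :
    groupCohomology.cocycles₁ (tameH n k (one_le_two.trans hk)) :=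
  ⟨tameFun n k, (groupCohomology.mem_cocycles₁_iff _).2 fun g h => by
    obtain ⟨σ, rfl⟩ := proj_surjective n k g
    obtain ⟨τ, rfl⟩ := proj_surjective n k h
    change tameFun n k _ = tameRep n k _ _ (tameFun n k _) + tameFun n k _
    rw [← _root_.map_mul, tameFun_proj hk, tameFun_proj hk, tameFun_proj hk, tameRep_proj,
      moritaFun_mul]⟩

theorem isCrossed_comp_proj (hk : 1 ≤ k) (φ : groupCohomology.cocycles₁ (tameH n k hk)) :
    IsCrossed fun σ => (φ (proj n k σ) : H n) := by
  intro σ τ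
  have h := (groupCohomology.mem_cocycles₁_iff _).1 φ.2 (proj n k σ) (proj n k τ)
  rw [← _root_.map_mul] at h
  refine h.trans ?_
  rw [← tameRep_proj n k hk]
  rfl

/-- Inflation along a surjection is injective on H¹, so principality may be tested on Aut F_n. -/
theorem mem_coboundaries_iff (hk : 1 ≤ k) (φ : groupCohomology.cocycles₁ (tameH n k hk)) :
    ⇑φ ∈ groupCohomology.coboundaries₁ (tameH n k hk) ↔
      ∃ x : H n, ∀ σ, (φ (proj n k σ) : H n) = abRep (F n) σ x - x := by
  constructor
  · rintro ⟨x, hx⟩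
    refine ⟨x, fun σ => ?_⟩
    rw [← hx, ← tameRep_proj n k hk]
    rfl
  · rintro ⟨x, hx⟩
    refine ⟨x, funext fun g => ?_⟩
    obtain ⟨σ, rfl⟩ := proj_surjective n k g
    refine Eq.trans ?_ (hx σ).symm
    rw [← tameRep_proj n k hk]
    rfl

theorem zsmul_H1π_eq_zero (hn : 2 ≤ n) (hk : 2 ≤ k) {m : ℤ}
    (h : m • groupCohomology.H1π (tameH n k (one_le_two.trans hk)) (tameCocycle n k hk) = 0) :
    m = 0 := by
  rw [← map_zsmul, groupCohomology.H1π_eq_zero_iff, mem_coboundaries_iff] at h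
  obtain ⟨x, hx⟩ := h
  refine moritaFun_not_principal hn (x := x) fun σ => ?_
  rw [← hx, ← tameFun_proj hk]
  rfl

theorem exists_zsmul_H1π_eq (hn : 2 ≤ n) (hk : 2 ≤ k)
    (y : groupCohomology.H1 (tameH n k (one_le_two.trans hk))) :
    ∃ m : ℤ, m • groupCohomology.H1π (tameH n k (one_le_two.trans hk)) (tameCocycle n k hk) =
      y := by
  induction y using groupCohomology.H1_induction_on with
  | h φ =>
    obtain ⟨m, x, hx⟩ := (isCrossed_comp_proj _ φ).exists_eq_smul_moritaFun_add hn
    refine ⟨m, ?_⟩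
    rw [eq_comm, ← sub_eq_zero, ← map_zsmul, ← map_sub,
      groupCohomology.H1π_eq_zero_iff, mem_coboundaries_iff]
    refine ⟨x, fun σ => ?_⟩
    have h := hx σ
    rw [← tameFun_proj hk] at h
    change (φ (proj n k σ) : H n) - m • tameFun n k (proj n k σ) = _
    rw [h, add_sub_cancel_left]

end Tame

end TameAut

end

/-- For `n, k ≥ 2`, `H¹(T_{n,k}, H)` is infinite cyclic, generated by Morita's crossed homomorphism.

`fM` is Morita's crossed homomorphism on `Aut F_n`: its values, viewed as group elements of `ℤ[H]`,
are `sgn(σ) det(r_M(σ))`. `f` is the crossed homomorphism on `T_{n,k}` to which it descends. -/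
theorem mainTheorem5 (n k : ℕ) (hn : 2 ≤ n) (hk : 2 ≤ k) :
    ∃ fM : groupCohomology.cocycles₁ (TameAut.autH n),
      (∀ σ : MulAut (TameAut.F n),
        MonoidAlgebra.of ℤ (TameAut.HMul n) (Additive.toMul (fM σ : TameAut.H n)) =
          TameAut.moritaElt n σ) ∧
      ∃ f : groupCohomology.cocycles₁ (TameAut.tameH n k (one_le_two.trans hk)),
        (∀ σ : MulAut (TameAut.F n), (f (TameAut.proj n k σ) : TameAut.H n) = fM σ) ∧
        Nonempty (groupCohomology.H1 (TameAut.tameH n k (one_le_two.trans hk)) ≃+ ℤ) ∧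
        AddSubgroup.zmultiples (groupCohomology.H1π (TameAut.tameH n k (one_le_two.trans hk)) f) = ⊤ := by
  refine ⟨TameAut.moritaCocycle n, TameAut.of_moritaFun, TameAut.tameCocycle n k hk,
    TameAut.tameFun_proj hk, ⟨(AddEquiv.ofBijective (zmultiplesHom _
      (groupCohomology.H1π (TameAut.tameH n k (one_le_two.trans hk))
        (TameAut.tameCocycle n k hk))) ⟨?_, fun y => ?_⟩).symm⟩, ?_⟩
  · exact (injective_iff_map_eq_zero _).2 fun m hm => TameAut.zsmul_H1π_eq_zero hn hk hm
  · exact TameAut.exists_zsmul_H1π_eq hn hk y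
  · exact (AddSubgroup.eq_top_iff' _).2 fun y =>
      AddSubgroup.mem_zmultiples_iff.2 (TameAut.exists_zsmul_H1π_eq hn hk y)
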